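/- Let $h:\mathbb R\to\mathbb R$ be a bounded measurable function with $h(x)=x+O(x^2)$ as $x\to0$, let $\sigma^2\ge 0$ and $b$ be real constants, and let $\Lambda$ be a measure on $\mathbb R\setminus\{0\}$ with $\int (|x|^2\wedge 1)\,d\Lambda(x)<\infty$. Let $X$ be an infinitely divisible real random variable (that is, for every $n\ge1$, $X$ has the same distribution as the sum of some $n$ i.i.d. random variables) with characteristic function $$\mathbb E e^{iuX}=\exp\Bigl(ibu-\tfrac12\sigma^2u^2+\int_{-\infty}^{\infty}\bigl(e^{iux}-1-iuh(x)\bigr)\,d\Lambda(x)\Bigr),\qquad u\in\mathbb R .$$ Then for every $t\in\mathbb R$ the integral $\int_{-\infty}^{\infty}(e^{tx}-1-th(x))\,d\Lambda(x)$ is well defined in $(-\infty,\infty]$ (the negative part of the integrand has finite integral), and $$\mathbb E e^{tX}=\exp\Bigl(bt+\tfrac12\sigma^2t^2+\int_{-\infty}^{\infty}\bigl(e^{tx}-1-th(x)\bigr)\,d\Lambda(x)\Bigr)\le\infty ,$$ where $\exp(\infty)=\infty$. In particular, for every $t\in\mathbb R$, $$\mathbb E e^{tX}<\infty\iff\int_{-\infty}^{\infty}\bigl(e^{tx}-1-th(x)\bigr)\,d\Lambda(x)<\infty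 ;$$ for $t>0$ this holds if and only if $\int_{x>1}e^{tx}\,d\Lambda(x)<\infty$, and for $t<0$ if and only if $\int_{x<-1}e^{tx}\,d\Lambda(x)<\infty$. -/

import Mathlib

open MeasureTheory ProbabilityTheory Filter Topology Asymptotics
open scoped ENNReal

noncomputable section

/-- A probability law `μ` on `ℝ` is infinitely divisible if for every `n ≥ 1` there are
i.i.d. random variables `Y 0, …, Y (n - 1)` on some probability space
whose sum has law `μ`. -/
def IsInfinitelyDivisible (μ : Measure ℝ) : Prop :=
  ∀ n : ℕ, 1 ≤ n →
    ∃ (Ω : Type) (_ : MeasurableSpace Ω) (P : Measure Ω) (Y : Fin n → Ω → ℝ),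
      IsProbabilityMeasure P ∧
      (∀ i, Measurable (Y i)) ∧
      iIndepFun Y P ∧
      (∀ i j, P.map (Y i) = P.map (Y j)) ∧
      P.map (fun ω => ∑ i, Y i ω) = μ

/-- The admissible centering functions: bounded measurable `h : ℝ → ℝ` with
`h x = x + O(x ^ 2)` as `x → 0`. -/
structure IsCenteringFunction (h : ℝ → ℝ) : Prop where
  measurable : Measurable h
  bounded : ∃ C : ℝ, ∀ x, |h x| ≤ C
  isBigO : (fun x => h x - x) =O[𝓝[≠] 0] (fun x => x ^ 2)

/-- A Lévy measure. A measure on `ℝ \ {0}` is regarded as a measure on `ℝ` that does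
not charge `0`. -/
structure IsLevyMeasure (Λ : Measure ℝ) : Prop where
  zero : Λ {0} = 0
  lintegral_lt_top : ∫⁻ x, ENNReal.ofReal (min (|x| ^ 2) 1) ∂Λ < ∞

/-- `μ` has characteristics `(σ2, b, Λ)` with respect to the centering function `h`:
its characteristic function has the Lévy–Khinchin form with these parameters. The integrand
is integrable whenever `h` is a centering function and `Λ` is a Lévy measure. -/
structure HasCharacteristics (μ : Measure ℝ) (h : ℝ → ℝ) (σ2 b : ℝ) (Λ : Measure ℝ) :
    Prop where
  nonneg : 0 ≤ σ2
  levy : IsLevyMeasure Λ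
  charFun_eq : ∀ t : ℝ, charFun μ t =
    Complex.exp (Complex.I * b * t - (1 / 2) * σ2 * t ^ 2 +
      ∫ x, (Complex.exp (Complex.I * t * x) - 1 - Complex.I * t * h x) ∂Λ)

/-- The extended-real integral `∫ f⁺ - ∫ f⁻`. It is meaningful as soon as one of the two
parts is finite. -/
def extIntegral (Λ : Measure ℝ) (f : ℝ → ℝ) : EReal :=
  ((∫⁻ x, ENNReal.ofReal (f x) ∂Λ : ℝ≥0∞) : EReal) -
    ((∫⁻ x, ENNReal.ofReal (-f x) ∂Λ : ℝ≥0∞) : EReal)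

end

/-!
# Exponential moments of infinitely divisible laws

Let `μ` be the law of `X` and let `Λ` be its Lévy measure. Removing the jumps of absolute value at
most `1 / (n + 1)` leaves a finite measure `ν`, and the corresponding law is a Gaussian law
convolved with a compound Poisson law. For such laws both the characteristic function and the
exponential moments are explicit (`charFun_gaussConvExp`, `lintegral_exp_gaussConvExp`). Their
characteristic functions converge to that of `μ`, hence by Lévy's theorem they converge weakly to
`μ` (`tendsto_lintegral_min_exp_levyApprox`). It remains to pass to the limit in the moments.

* If `exp (t x) - 1 - t h x` is `Λ`-integrable, the moments of the approximations converge to the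
  asserted value, and Fatou's lemma gives `≤` (`lintegral_exp_le`).
* For the lower bound, the jumps larger than `R` are discarded as well. The unnormalised compound
  Poisson measure `∑ ν^{∗k} / k!` is monotone in `ν`, so this yields measures below the
  approximations of `μ`. They have uniformly bounded moments of order `2 t`, so their moments of
  order `t` do not escape to infinity, and `E exp (t X)` is at least the value of the formula
  with `exp (t x)` replaced by `exp (t x) 1_{|x| ≤ R}` (`le_lintegral_exp`). These integrands
  increase with `R` to `exp (t x) - 1 - t h x`. By monotone convergence, a finite moment
  forces that function to be integrable (`integrable_compExp_of_lintegral_exp_lt_top`), and then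
  `≥` follows in the limit (`lintegral_exp_eq`).

The integrand differs from `exp (t x) 1_{|x| > 1}` by at most a multiple of `min (x ^ 2) 1`
(`IsCenteringFunction.abs_compExp_le`), so its integrability is decided by the tail of `Λ` on the
side where `exp (t x)` grows.
-/

/-! ### Convolution exponentials -/

/-- The `k`-fold convolution power of a measure on `ℝ`; the zeroth power is the unit mass at `0`. -/
noncomputable def convPow (ν : Measure ℝ) : ℕ → Measure ℝ
  | 0 => Measure.dirac 0
  | k + 1 => convPow ν k ∗ ν

/-- The convolution exponential `∑ ν^{∗k} / k!`. It is left unnormalised, so that it is monotone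
in `ν`; dividing it by its total mass `exp (ν ℝ)` gives the compound Poisson law with jump
measure `ν`. -/
noncomputable def convExp (ν : Measure ℝ) : Measure ℝ :=
  Measure.sum fun k => ENNReal.ofReal ((k.factorial : ℝ)⁻¹) • convPow ν k

instance isFiniteMeasure_convPow (ν : Measure ℝ) [IsFiniteMeasure ν] (k : ℕ) :
    IsFiniteMeasure (convPow ν k) := by
  induction k with
  | zero => exact inferInstanceAs (IsFiniteMeasure (Measure.dirac 0))
  | succ k ih => exact inferInstanceAs (IsFiniteMeasure (convPow ν k ∗ ν))

lemma lintegral_exp_conv (μ ν : Measure ℝ) [SFinite ν] (t : ℝ) :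
    ∫⁻ x, ENNReal.ofReal (Real.exp (t * x)) ∂(μ ∗ ν) =
      (∫⁻ x, ENNReal.ofReal (Real.exp (t * x)) ∂μ) *
        ∫⁻ x, ENNReal.ofReal (Real.exp (t * x)) ∂ν := by
  rw [Measure.lintegral_conv (by fun_prop)]
  simp_rw [mul_add, Real.exp_add, ENNReal.ofReal_mul (Real.exp_nonneg _)]
  rw [← lintegral_mul_const _ (by fun_prop)]
  exact lintegral_congr fun x => lintegral_const_mul _ (by fun_prop)

lemma lintegral_exp_convPow (ν : Measure ℝ) [IsFiniteMeasure ν] (t : ℝ) (k : ℕ) :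
    ∫⁻ x, ENNReal.ofReal (Real.exp (t * x)) ∂(convPow ν k) =
      (∫⁻ x, ENNReal.ofReal (Real.exp (t * x)) ∂ν) ^ k := by
  induction k with
  | zero => simp [convPow]
  | succ k ih => rw [convPow, lintegral_exp_conv, ih, pow_succ]

lemma lintegral_exp_convExp {ν : Measure ℝ} [IsFiniteMeasure ν] {t : ℝ}
    (hν : Integrable (fun x => Real.exp (t * x)) ν) :
    ∫⁻ x, ENNReal.ofReal (Real.exp (t * x)) ∂(convExp ν) =
      ENNReal.ofReal (Real.exp (∫ x, Real.exp (t * x) ∂ν)) := by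
  have h0 : 0 ≤ ∫ x, Real.exp (t * x) ∂ν := integral_nonneg fun x => Real.exp_nonneg _
  have hexp (a : ℝ) : Real.exp a = ∑' k : ℕ, a ^ k / k.factorial := by
    rw [Real.exp_eq_exp_ℝ, NormedSpace.exp_eq_tsum_div]
  rw [convExp, lintegral_sum_measure, hexp (∫ x, Real.exp (t * x) ∂ν),
    ENNReal.ofReal_tsum_of_nonneg (fun n => div_nonneg (pow_nonneg h0 n) (Nat.cast_nonneg _))
      (Real.summable_pow_div_factorial _)]
  refine tsum_congr fun k => ?_
  rw [lintegral_smul_measure, lintegral_exp_convPow,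
    ← ofReal_integral_eq_lintegral_ofReal hν (ae_of_all _ fun x => Real.exp_nonneg _),
    ← ENNReal.ofReal_pow h0, smul_eq_mul, ← ENNReal.ofReal_mul (by positivity)]
  congr 1
  ring

lemma convExp_univ (ν : Measure ℝ) [IsFiniteMeasure ν] :
    convExp ν Set.univ = ENNReal.ofReal (Real.exp (ν.real Set.univ)) := by
  have := lintegral_exp_convExp (ν := ν) (t := 0) (by simp)
  simpa using this

instance isFiniteMeasure_convExp (ν : Measure ℝ) [IsFiniteMeasure ν] :
    IsFiniteMeasure (convExp ν) :=
  ⟨by rw [convExp_univ]; exact ENNReal.ofReal_lt_top⟩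

lemma charFun_convPow (ν : Measure ℝ) [IsFiniteMeasure ν] (u : ℝ) (k : ℕ) :
    charFun (convPow ν k) u = charFun ν u ^ k := by
  induction k with
  | zero => simp [convPow, charFun_dirac]
  | succ k ih => rw [convPow, charFun_conv, ih, pow_succ]

lemma charFun_ofReal_smul {c : ℝ} (hc : 0 ≤ c) (μ : Measure ℝ) (u : ℝ) :
    charFun (ENNReal.ofReal c • μ) u = c * charFun μ u := by
  rw [charFun_apply, charFun_apply, integral_smul_measure, ENNReal.toReal_ofReal hc,
    Complex.real_smul]

lemma charFun_convExp (ν : Measure ℝ) [IsFiniteMeasure ν] (u : ℝ) :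
    charFun (convExp ν) u = Complex.exp (charFun ν u) := by
  have hint : Integrable (fun x : ℝ => Complex.exp (u * x * Complex.I)) (convExp ν) := by
    refine Integrable.of_bound (C := 1) (by fun_prop) (ae_of_all _ fun x => ?_)
    rw [← Complex.ofReal_mul, Complex.norm_exp_ofReal_mul_I]
  have hs := hasSum_integral_measure (μ := fun k : ℕ =>
    ENNReal.ofReal ((k.factorial : ℝ)⁻¹) • convPow ν k) hint
  have hexp : Complex.exp (charFun ν u) = ∑' k : ℕ, charFun ν u ^ k / k.factorial := by
    rw [Complex.exp_eq_exp_ℂ, NormedSpace.exp_eq_tsum_div]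
  rw [hexp, charFun_apply_real, convExp, ← hs.tsum_eq]
  refine tsum_congr fun k => ?_
  rw [← charFun_apply_real, charFun_ofReal_smul (by positivity), charFun_convPow]
  push_cast
  ring

lemma conv_mono {μ μ' ν ν' : Measure ℝ} [SFinite ν'] (hμ : μ ≤ μ') (hν : ν ≤ ν') :
    μ ∗ ν ≤ μ' ∗ ν' :=
  Measure.map_mono (Measure.prod_mono hμ hν) measurable_add

lemma convPow_mono {ν ν' : Measure ℝ} [IsFiniteMeasure ν'] (hν : ν ≤ ν') (k : ℕ) :
    convPow ν k ≤ convPow ν' k := by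
  induction k with
  | zero => exact le_rfl
  | succ k ih => exact conv_mono ih hν

lemma convExp_mono {ν ν' : Measure ℝ} [IsFiniteMeasure ν'] (hν : ν ≤ ν') :
    convExp ν ≤ convExp ν' := by
  refine Measure.le_iff.2 fun s hs => ?_
  rw [convExp, convExp, Measure.sum_apply _ hs, Measure.sum_apply _ hs]
  refine ENNReal.tsum_le_tsum fun k => ?_
  simp only [Measure.smul_apply, smul_eq_mul]
  exact mul_le_mul_right (convPow_mono hν k s) _

/-! ### Gaussian plus compound Poisson laws -/

/-- The measure `exp (-l) • (convExp ν ∗ N(m, v))`. For `l = ν ℝ` it is the law of the sum of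
independent Gaussian and compound Poisson variables. The weight `l` is kept free, so that jumps
can be removed from `ν` without renormalising. -/
noncomputable def gaussConvExp (l : ℝ) (ν : Measure ℝ) (m : ℝ) (v : NNReal) : Measure ℝ :=
  ENNReal.ofReal (Real.exp (-l)) • (convExp ν ∗ gaussianReal m v)

lemma gaussConvExp_mono {ν ν' : Measure ℝ} [IsFiniteMeasure ν'] (hν : ν ≤ ν') (l m : ℝ)
    (v : NNReal) : gaussConvExp l ν m v ≤ gaussConvExp l ν' m v := by
  refine Measure.le_iff.2 fun s _ => ?_
  simp only [gaussConvExp, Measure.smul_apply, smul_eq_mul]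
  exact mul_le_mul_right (conv_mono (convExp_mono hν) le_rfl s) _

lemma lintegral_exp_gaussianReal (m : ℝ) (v : NNReal) (t : ℝ) :
    ∫⁻ x, ENNReal.ofReal (Real.exp (t * x)) ∂(gaussianReal m v) =
      ENNReal.ofReal (Real.exp (m * t + v * t ^ 2 / 2)) := by
  rw [← ofReal_integral_eq_lintegral_ofReal (integrable_exp_mul_gaussianReal t)
    (ae_of_all _ fun x => Real.exp_nonneg _)]
  rw [← mgf_gaussianReal (X := id) (p := gaussianReal m v) Measure.map_id t]
  rfl

lemma lintegral_exp_gaussConvExp {ν : Measure ℝ} [IsFiniteMeasure ν] {t : ℝ}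
    (hν : Integrable (fun x => Real.exp (t * x)) ν) (l m : ℝ) (v : NNReal) :
    ∫⁻ x, ENNReal.ofReal (Real.exp (t * x)) ∂(gaussConvExp l ν m v) =
      ENNReal.ofReal (Real.exp (m * t + v * t ^ 2 / 2 + (∫ x, Real.exp (t * x) ∂ν) - l)) := by
  rw [gaussConvExp, lintegral_smul_measure, lintegral_exp_conv, lintegral_exp_convExp hν,
    lintegral_exp_gaussianReal, smul_eq_mul, ← ENNReal.ofReal_mul (Real.exp_nonneg _),
    ← ENNReal.ofReal_mul (Real.exp_nonneg _), ← Real.exp_add, ← Real.exp_add]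
  congr 2
  ring

lemma isProbabilityMeasure_gaussConvExp (ν : Measure ℝ) [IsFiniteMeasure ν] (m : ℝ)
    (v : NNReal) : IsProbabilityMeasure (gaussConvExp (ν.real Set.univ) ν m v) := by
  refine ⟨?_⟩
  have := lintegral_exp_gaussConvExp (ν := ν) (t := 0) (by simp) (ν.real Set.univ) m v
  simpa using this

lemma charFun_gaussConvExp (ν : Measure ℝ) [IsFiniteMeasure ν] (l m : ℝ) (v : NNReal) (u : ℝ) :
    charFun (gaussConvExp l ν m v) u =
      Complex.exp (u * m * Complex.I - v * u ^ 2 / 2 + charFun ν u - l) := by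
  rw [gaussConvExp, charFun_ofReal_smul (Real.exp_nonneg _), charFun_conv, charFun_convExp,
    charFun_gaussianReal, Complex.ofReal_exp, ← Complex.exp_add, ← Complex.exp_add]
  congr 1
  push_cast
  ring

/-! ### Integrability against a Lévy measure -/

lemma IsLevyMeasure.integrable_min {Λ : Measure ℝ} (hΛ : IsLevyMeasure Λ) :
    Integrable (fun x : ℝ => min (|x| ^ 2) 1) Λ := by
  have hm : Measurable fun x : ℝ => min (|x| ^ 2) 1 := by fun_prop
  refine ⟨hm.aestronglyMeasurable, ?_⟩
  rw [hasFiniteIntegral_iff_ofReal (ae_of_all _ fun x => by positivity)]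
  exact hΛ.lintegral_lt_top

lemma IsLevyMeasure.ae_ne_zero {Λ : Measure ℝ} (hΛ : IsLevyMeasure Λ) : ∀ᵐ x ∂Λ, x ≠ 0 := by
  rw [ae_iff]
  simpa using hΛ.zero

lemma IsLevyMeasure.measure_abs_gt_lt_top {Λ : Measure ℝ} (hΛ : IsLevyMeasure Λ) {ε : ℝ}
    (hε : 0 < ε) : Λ {x | ε < |x|} < ∞ := by
  have hc : 0 < min (ε ^ 2) 1 := by positivity
  refine (measure_mono fun x hx => ?_).trans_lt (hΛ.integrable_min.measure_ge_lt_top hc)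
  have hx' : ε < |x| := hx
  change min (ε ^ 2) 1 ≤ min (|x| ^ 2) 1
  gcongr

lemma measurableSet_abs_gt (ε : ℝ) : MeasurableSet {x : ℝ | ε < |x|} :=
  measurableSet_lt measurable_const measurable_abs

/-- The jumps of absolute value larger than `1 / (n + 1)`; there are finitely many of them on
average, even when the Lévy measure is infinite. -/
noncomputable def bigJumps (Λ : Measure ℝ) (n : ℕ) : Measure ℝ :=
  Λ.restrict {x | 1 / ((n : ℝ) + 1) < |x|}

lemma IsLevyMeasure.isFiniteMeasure_bigJumps {Λ : Measure ℝ} (hΛ : IsLevyMeasure Λ) (n : ℕ) :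
    IsFiniteMeasure (bigJumps Λ n) :=
  ⟨by rw [bigJumps, Measure.restrict_apply_univ]; exact hΛ.measure_abs_gt_lt_top (by positivity)⟩

lemma IsLevyMeasure.tendsto_integral_bigJumps {Λ : Measure ℝ} (hΛ : IsLevyMeasure Λ)
    {E : Type*} [NormedAddCommGroup E] [NormedSpace ℝ E] {F : ℝ → E} (hF : Integrable F Λ) :
    Tendsto (fun n => ∫ x, F x ∂(bigJumps Λ n)) atTop (𝓝 (∫ x, F x ∂Λ)) := by
  have hU : Λ.restrict (⋃ n : ℕ, {x : ℝ | 1 / ((n : ℝ) + 1) < |x|}) = Λ := by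
    refine Measure.restrict_eq_self_of_ae_mem ?_
    filter_upwards [hΛ.ae_ne_zero] with x hx
    exact Set.mem_iUnion.2 (exists_nat_one_div_lt (abs_pos.2 hx))
  have := tendsto_setIntegral_of_monotone (μ := Λ) (f := F)
    (s := fun n : ℕ => {x : ℝ | 1 / ((n : ℝ) + 1) < |x|}) (fun n => measurableSet_abs_gt _)
    (fun i j hij x hx =>
      (Nat.one_div_le_one_div hij).trans_lt (Set.mem_ofPred.1 hx)) hF.integrableOn
  rwa [hU] at this

/-! ### The compensated exponential -/

lemma IsCenteringFunction.abs_sub_le {h : ℝ → ℝ} (hh : IsCenteringFunction h) :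
    ∃ C : ℝ, 0 ≤ C ∧ ∀ x : ℝ, x ≠ 0 → |x| ≤ 1 → |h x - x| ≤ C * |x| ^ 2 := by
  obtain ⟨B, hB⟩ := hh.bounded
  obtain ⟨c, hc, hcb⟩ := hh.isBigO.exists_pos
  obtain ⟨δ, hδ, hball⟩ := Metric.mem_nhdsWithin_iff.1 hcb.bound
  have hB0 : 0 ≤ B := (abs_nonneg _).trans (hB 0)
  -- The `O(x ^ 2)` bound holds for `|x| < δ`; for `δ ≤ |x| ≤ 1` boundedness of `h` suffices.
  refine ⟨c + (B + 1) / δ ^ 2, by positivity, fun x hx hx1 => ?_⟩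
  rw [add_mul]
  by_cases hxδ : |x| < δ
  · have h1 : |h x - x| ≤ c * |x| ^ 2 := by
      have := hball (a := x) ⟨by simpa using hxδ, hx⟩
      simpa using this
    have : 0 ≤ (B + 1) / δ ^ 2 * |x| ^ 2 := by positivity
    linarith
  · have h1 : |h x - x| ≤ B + 1 := (abs_sub _ _).trans (add_le_add (hB x) hx1)
    have h2 : B + 1 ≤ (B + 1) / δ ^ 2 * |x| ^ 2 := by
      rw [div_mul_eq_mul_div, le_div_iff₀ (by positivity)]
      have : δ ≤ |x| := not_lt.1 hxδ
      gcongr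
    have : 0 ≤ c * |x| ^ 2 := by positivity
    linarith

/-- Near the origin the centering makes the integrand of order `x ^ 2`; away from it only the
exponential itself can be unbounded. -/
lemma IsCenteringFunction.norm_exp_sub_le {h : ℝ → ℝ} (hh : IsCenteringFunction h) (z : ℂ) :
    ∃ C : ℝ, 0 ≤ C ∧ ∀ x : ℝ, x ≠ 0 →
      (|x| ≤ 1 → ‖Complex.exp (z * x) - 1 - z * h x‖ ≤ C * min (|x| ^ 2) 1) ∧
      (1 < |x| → ‖1 + z * h x‖ ≤ C * min (|x| ^ 2) 1) := by
  obtain ⟨B, hB⟩ := hh.bounded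
  obtain ⟨c, hc, hcb⟩ := hh.abs_sub_le
  have hB0 : 0 ≤ B := (abs_nonneg _).trans (hB 0)
  refine ⟨‖z‖ ^ 2 * Real.exp ‖z‖ + ‖z‖ * c + (1 + ‖z‖ * B), by positivity, fun x hx =>
    ⟨fun hx1 => ?_, fun hx1 => ?_⟩⟩
  · have hmin : min (|x| ^ 2) 1 = |x| ^ 2 := min_eq_left (by nlinarith [abs_nonneg x])
    have hzx : ‖z * (x : ℂ)‖ = ‖z‖ * |x| := by simp
    have h1 : ‖Complex.exp (z * x) - (1 + z * x)‖ ≤ ‖z‖ ^ 2 * Real.exp ‖z‖ * |x| ^ 2 := by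
      have h2 := Complex.norm_exp_sub_sum_le_norm_mul_exp (z * x) 2
      simp only [Finset.sum_range_succ, Finset.range_zero, Finset.sum_empty, pow_zero, pow_one,
        Nat.factorial, Nat.cast_one, div_one, zero_add, mul_one] at h2
      refine h2.trans ?_
      rw [hzx, mul_pow, mul_right_comm]
      gcongr
      exact mul_le_of_le_one_right (norm_nonneg _) hx1
    have h3 : ‖z * ((x : ℂ) - h x)‖ ≤ ‖z‖ * c * |x| ^ 2 := by
      rw [norm_mul, ← Complex.ofReal_sub, Complex.norm_real, Real.norm_eq_abs, abs_sub_comm,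
        mul_assoc]
      gcongr
      exact hcb x hx hx1
    have h4 : Complex.exp (z * x) - 1 - z * h x =
        (Complex.exp (z * x) - (1 + z * x)) + z * ((x : ℂ) - h x) := by ring
    rw [h4, hmin, add_mul, add_mul]
    have : 0 ≤ (1 + ‖z‖ * B) * |x| ^ 2 := by positivity
    linarith [norm_add_le (Complex.exp (z * x) - (1 + z * x)) (z * ((x : ℂ) - h x))]
  · have hmin : min (|x| ^ 2) 1 = 1 := min_eq_right (by nlinarith [abs_nonneg x])
    have h1 : ‖1 + z * (h x : ℂ)‖ ≤ 1 + ‖z‖ * B := by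
      refine (norm_add_le _ _).trans ?_
      rw [norm_one, norm_mul, Complex.norm_real]
      gcongr
      exact hB x
    rw [hmin, mul_one]
    have : 0 ≤ ‖z‖ ^ 2 * Real.exp ‖z‖ + ‖z‖ * c := by positivity
    linarith

lemma integrable_charFun_integrand {h : ℝ → ℝ} (hh : IsCenteringFunction h) {Λ : Measure ℝ}
    (hΛ : IsLevyMeasure Λ) (u : ℝ) :
    Integrable (fun x : ℝ =>
      Complex.exp (Complex.I * u * x) - 1 - Complex.I * u * h x) Λ := by
  obtain ⟨C, hC, hb⟩ := hh.norm_exp_sub_le (Complex.I * u)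
  have hm := hh.measurable
  refine Integrable.mono' (hΛ.integrable_min.const_mul (C + 1)) (by fun_prop) ?_
  filter_upwards [hΛ.ae_ne_zero] with x hx
  obtain ⟨h1, h2⟩ := hb x hx
  have hpos : 0 ≤ min (|x| ^ 2) 1 := by positivity
  rcases le_or_gt |x| 1 with hx1 | hx1
  · linarith [h1 hx1]
  · have hmin : min (|x| ^ 2) 1 = 1 := min_eq_right (by nlinarith [abs_nonneg x])
    have h3 : ‖Complex.exp (Complex.I * u * x)‖ = 1 := by
      rw [mul_assoc, ← Complex.ofReal_mul, mul_comm, Complex.norm_exp_ofReal_mul_I]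
    have h4 := h2 hx1
    rw [hmin] at h4 ⊢
    rw [sub_sub]
    linarith [norm_sub_le (Complex.exp (Complex.I * u * x)) (1 + Complex.I * u * h x)]

/-- The integrand `exp (t x) - 1 - t h x` with the exponential cut off outside `S`. -/
noncomputable def compExp (h : ℝ → ℝ) (t : ℝ) (S : Set ℝ) (x : ℝ) : ℝ :=
  S.indicator (fun y => Real.exp (t * y)) x - 1 - t * h x

lemma measurable_compExp {h : ℝ → ℝ} (hh : IsCenteringFunction h) (t : ℝ) {S : Set ℝ}
    (hS : MeasurableSet S) : Measurable (compExp h t S) := by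
  have hm := hh.measurable
  have : Measurable (S.indicator fun y => Real.exp (t * y)) :=
    Measurable.indicator (by fun_prop) hS
  unfold compExp
  fun_prop

/-- Up to an error integrable against every Lévy measure, uniformly in `S`, the integrand is the
exponential on the jumps of absolute value greater than `1`. -/
lemma IsCenteringFunction.abs_compExp_le {h : ℝ → ℝ} (hh : IsCenteringFunction h) (t : ℝ) :
    ∃ C : ℝ, 0 ≤ C ∧ ∀ S : Set ℝ, Set.Icc (-1) 1 ⊆ S → ∀ x : ℝ, x ≠ 0 →
      |compExp h t S x - {y | 1 < |y|}.indicator (S.indicator fun y => Real.exp (t * y)) x| ≤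
        C * min (|x| ^ 2) 1 := by
  obtain ⟨C, hC, hb⟩ := hh.norm_exp_sub_le t
  refine ⟨C, hC, fun S hS x hx => ?_⟩
  rcases le_or_gt |x| 1 with hx1 | hx1
  · have h1 := (hb x hx).1 hx1
    rw [Set.indicator_of_notMem (by simpa using hx1), compExp,
      Set.indicator_of_mem (hS (abs_le.1 hx1)), sub_zero]
    exact_mod_cast h1
  · have h1 := (hb x hx).2 hx1
    rw [Set.indicator_of_mem (by simpa using hx1), compExp, sub_sub _ _ (t * h x),
      sub_sub_cancel_left, abs_neg]
    exact_mod_cast h1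

lemma integrable_compExp_iff {h : ℝ → ℝ} (hh : IsCenteringFunction h) {Λ : Measure ℝ}
    (hΛ : IsLevyMeasure Λ) (t : ℝ) {S : Set ℝ} (hS : MeasurableSet S)
    (hS1 : Set.Icc (-1) 1 ⊆ S) :
    Integrable (compExp h t S) Λ ↔
      Integrable ({y | 1 < |y|}.indicator (S.indicator fun y => Real.exp (t * y))) Λ := by
  obtain ⟨C, -, hb⟩ := hh.abs_compExp_le t
  have hm2 : Measurable ({y | 1 < |y|}.indicator (S.indicator fun y => Real.exp (t * y))) :=
    Measurable.indicator (Measurable.indicator (by fun_prop) hS) (measurableSet_abs_gt 1)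
  have hd : Integrable (fun x => compExp h t S x -
      {y | 1 < |y|}.indicator (S.indicator fun y => Real.exp (t * y)) x) Λ := by
    refine Integrable.mono' (hΛ.integrable_min.const_mul C)
      ((measurable_compExp hh t hS).sub hm2).aestronglyMeasurable ?_
    filter_upwards [hΛ.ae_ne_zero] with x hx using hb S hS1 x hx
  refine ⟨fun hi => ?_, fun hi => ?_⟩
  · refine (hi.sub hd).congr (ae_of_all _ fun x => ?_)
    simp
  · refine (hd.add hi).congr (ae_of_all _ fun x => ?_)
    simp

lemma integrable_compExp_Icc {h : ℝ → ℝ} (hh : IsCenteringFunction h) {Λ : Measure ℝ}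
    (hΛ : IsLevyMeasure Λ) (t : ℝ) {R : ℝ} (hR : 1 ≤ R) :
    Integrable (compExp h t (Set.Icc (-R) R)) Λ := by
  rw [integrable_compExp_iff hh hΛ t measurableSet_Icc (Set.Icc_subset_Icc (by linarith) hR),
    integrable_indicator_iff (measurableSet_abs_gt 1)]
  have : IsFiniteMeasure (Λ.restrict {y | 1 < |y|}) :=
    ⟨by rw [Measure.restrict_apply_univ]; exact hΛ.measure_abs_gt_lt_top one_pos⟩
  refine Integrable.of_bound (C := Real.exp (|t| * R))
    (Measurable.indicator (by fun_prop) measurableSet_Icc).aestronglyMeasurable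
    (ae_of_all _ fun x => ?_)
  rw [Real.norm_eq_abs, abs_of_nonneg (Set.indicator_nonneg (fun _ _ => Real.exp_nonneg _) _)]
  refine Set.indicator_le' (fun y hy => ?_) (fun y hy => Real.exp_nonneg _) x
  rw [Real.exp_le_exp]
  calc t * y ≤ |t * y| := le_abs_self _
    _ = |t| * |y| := abs_mul _ _
    _ ≤ |t| * R := by gcongr; exact abs_le.2 hy

lemma integrable_compExp_univ_iff {h : ℝ → ℝ} (hh : IsCenteringFunction h) {Λ : Measure ℝ}
    (hΛ : IsLevyMeasure Λ) (t : ℝ) :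
    Integrable (compExp h t Set.univ) Λ ↔
      ∫⁻ x in {y | 1 < |y|}, ENNReal.ofReal (Real.exp (t * x)) ∂Λ < ∞ := by
  rw [integrable_compExp_iff hh hΛ t MeasurableSet.univ (Set.subset_univ _),
    integrable_indicator_iff (measurableSet_abs_gt 1), Set.indicator_univ, IntegrableOn,
    ← hasFiniteIntegral_iff_ofReal (ae_of_all _ fun x => Real.exp_nonneg _)]
  exact ⟨fun hi => hi.2, fun hi => ⟨by fun_prop, hi⟩⟩

lemma setOf_one_lt_abs : {y : ℝ | 1 < |y|} = Set.Ioi 1 ∪ Set.Iio (-1) := by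
  ext y
  simp [lt_abs, lt_neg]

lemma IsLevyMeasure.setLIntegral_exp_lt_top {Λ : Measure ℝ} (hΛ : IsLevyMeasure Λ) {t : ℝ}
    {S : Set ℝ} (hS : S ⊆ {y | 1 < |y|}) (hneg : ∀ x ∈ S, t * x ≤ 0) :
    ∫⁻ x in S, ENNReal.ofReal (Real.exp (t * x)) ∂Λ < ∞ := by
  refine (setLIntegral_mono (g := fun _ => 1) measurable_const fun x hx => ?_).trans_lt ?_
  · rw [ENNReal.ofReal_le_one, Real.exp_le_one_iff]
    exact hneg x hx
  · rw [setLIntegral_one]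
    exact (measure_mono hS).trans_lt (hΛ.measure_abs_gt_lt_top one_pos)

lemma integrable_compExp_univ_iff_of_pos {h : ℝ → ℝ} (hh : IsCenteringFunction h) {Λ : Measure ℝ}
    (hΛ : IsLevyMeasure Λ) {t : ℝ} (ht : 0 < t) :
    Integrable (compExp h t Set.univ) Λ ↔
      ∫⁻ x in Set.Ioi 1, ENNReal.ofReal (Real.exp (t * x)) ∂Λ < ∞ := by
  have hneg : ∫⁻ x in Set.Iio (-1), ENNReal.ofReal (Real.exp (t * x)) ∂Λ < ∞ :=
    hΛ.setLIntegral_exp_lt_top (setOf_one_lt_abs ▸ Set.subset_union_right) fun x hx =>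
      mul_nonpos_of_nonneg_of_nonpos ht.le (by linarith [Set.mem_Iio.1 hx])
  rw [integrable_compExp_univ_iff hh hΛ, setOf_one_lt_abs]
  exact ⟨fun hi => (lintegral_mono_set Set.subset_union_left).trans_lt hi,
    fun hi => (lintegral_union_le _ _ _).trans_lt (ENNReal.add_lt_top.2 ⟨hi, hneg⟩)⟩

lemma integrable_compExp_univ_iff_of_neg {h : ℝ → ℝ} (hh : IsCenteringFunction h) {Λ : Measure ℝ}
    (hΛ : IsLevyMeasure Λ) {t : ℝ} (ht : t < 0) :
    Integrable (compExp h t Set.univ) Λ ↔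
      ∫⁻ x in Set.Iio (-1), ENNReal.ofReal (Real.exp (t * x)) ∂Λ < ∞ := by
  have hpos : ∫⁻ x in Set.Ioi 1, ENNReal.ofReal (Real.exp (t * x)) ∂Λ < ∞ :=
    hΛ.setLIntegral_exp_lt_top (setOf_one_lt_abs ▸ Set.subset_union_left) fun x hx =>
      mul_nonpos_of_nonpos_of_nonneg ht.le (by linarith [Set.mem_Ioi.1 hx])
  rw [integrable_compExp_univ_iff hh hΛ, setOf_one_lt_abs]
  exact ⟨fun hi => (lintegral_mono_set Set.subset_union_right).trans_lt hi,
    fun hi => (lintegral_union_le _ _ _).trans_lt (ENNReal.add_lt_top.2 ⟨hpos, hi⟩)⟩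

/-! ### Approximation by Gaussian plus compound Poisson laws -/

/-- The approximation, with Gaussian variance `v` and jumps `bigJumps Λ n`. The jumps outside `S`
are removed without renormalising, so that the measure increases with `S` and is a
probability measure for `S = univ`. -/
noncomputable def levyApprox (h : ℝ → ℝ) (v : NNReal) (b : ℝ) (Λ : Measure ℝ) (S : Set ℝ)
    (n : ℕ) : Measure ℝ :=
  gaussConvExp ((bigJumps Λ n).real Set.univ) ((bigJumps Λ n).restrict S)
    (b - ∫ x, h x ∂(bigJumps Λ n)) v

lemma IsCenteringFunction.integrable {h : ℝ → ℝ} (hh : IsCenteringFunction h) (ν : Measure ℝ)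
    [IsFiniteMeasure ν] : Integrable h ν := by
  obtain ⟨B, hB⟩ := hh.bounded
  exact Integrable.of_bound hh.measurable.aestronglyMeasurable (C := B) (ae_of_all _ hB)

lemma integral_sub_one_sub_const_mul {𝕜 : Type*} [RCLike 𝕜] {ν : Measure ℝ} [IsFiniteMeasure ν]
    {f g : ℝ → 𝕜} (hf : Integrable f ν) (hg : Integrable g ν) (c : 𝕜) :
    ∫ x, (f x - 1 - c * g x) ∂ν = (∫ x, f x ∂ν) - ν.real Set.univ - c * ∫ x, g x ∂ν := by
  have h1 : ∫ x, (f x - 1) ∂ν = (∫ x, f x ∂ν) - ν.real Set.univ := by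
    rw [integral_sub hf (integrable_const _), integral_const, RCLike.real_smul_eq_coe_mul, mul_one]
  have h2 : Integrable (fun x => f x - 1) ν := hf.sub (integrable_const _)
  rw [integral_sub h2 (hg.const_mul c), h1, integral_const_mul]

lemma isProbabilityMeasure_levyApprox {Λ : Measure ℝ} (hΛ : IsLevyMeasure Λ) (h : ℝ → ℝ)
    (v : NNReal) (b : ℝ) (n : ℕ) : IsProbabilityMeasure (levyApprox h v b Λ Set.univ n) := by
  have := hΛ.isFiniteMeasure_bigJumps n
  rw [levyApprox, Measure.restrict_univ]
  exact isProbabilityMeasure_gaussConvExp _ _ _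

lemma levyApprox_le {Λ : Measure ℝ} (hΛ : IsLevyMeasure Λ) (h : ℝ → ℝ) (v : NNReal) (b : ℝ)
    (S : Set ℝ) (n : ℕ) : levyApprox h v b Λ S n ≤ levyApprox h v b Λ Set.univ n := by
  have := hΛ.isFiniteMeasure_bigJumps n
  refine gaussConvExp_mono ?_ _ _ _
  rw [Measure.restrict_univ]
  exact Measure.restrict_le_self

lemma charFun_levyApprox {h : ℝ → ℝ} (hh : IsCenteringFunction h) {Λ : Measure ℝ}
    (hΛ : IsLevyMeasure Λ) (v : NNReal) (b : ℝ) (n : ℕ) (u : ℝ) :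
    charFun (levyApprox h v b Λ Set.univ n) u =
      Complex.exp (Complex.I * b * u - (1 / 2) * v * u ^ 2 +
        ∫ x, (Complex.exp (Complex.I * u * x) - 1 - Complex.I * u * h x) ∂(bigJumps Λ n)) := by
  have := hΛ.isFiniteMeasure_bigJumps n
  have hh' : Integrable (fun x => (h x : ℂ)) (bigJumps Λ n) := (hh.integrable _).ofReal
  have he : Integrable (fun x : ℝ => Complex.exp (Complex.I * u * x)) (bigJumps Λ n) := by
    refine Integrable.of_bound (C := 1) (by fun_prop) (ae_of_all _ fun x => ?_)
    rw [mul_assoc, ← Complex.ofReal_mul, mul_comm, Complex.norm_exp_ofReal_mul_I]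
  have hc : charFun (bigJumps Λ n) u = ∫ x, Complex.exp (Complex.I * u * x) ∂(bigJumps Λ n) := by
    rw [charFun_apply_real]
    exact integral_congr_ae (ae_of_all _ fun x => by ring_nf)
  rw [levyApprox, Measure.restrict_univ, charFun_gaussConvExp, hc,
    integral_sub_one_sub_const_mul he hh', integral_complex_ofReal]
  congr 1
  push_cast
  simp only [Complex.coe_algebraMap]
  ring

lemma tendsto_charFun_levyApprox {h : ℝ → ℝ} (hh : IsCenteringFunction h) {Λ : Measure ℝ}
    (hΛ : IsLevyMeasure Λ) (v : NNReal) (b : ℝ) (u : ℝ) :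
    Tendsto (fun n => charFun (levyApprox h v b Λ Set.univ n) u) atTop
      (𝓝 (Complex.exp (Complex.I * b * u - (1 / 2) * v * u ^ 2 +
        ∫ x, (Complex.exp (Complex.I * u * x) - 1 - Complex.I * u * h x) ∂Λ))) := by
  simp_rw [charFun_levyApprox hh hΛ]
  exact (Complex.continuous_exp.tendsto _).comp
    (tendsto_const_nhds.add (hΛ.tendsto_integral_bigJumps (integrable_charFun_integrand hh hΛ u)))

/-- The weight `exp (-ν ℝ)`, the drift correction `-∫ h ∂ν` and the jumps in `S` combine into the
integral of the truncated integrand over `ν = bigJumps Λ n`. -/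
lemma lintegral_exp_levyApprox {h : ℝ → ℝ} (hh : IsCenteringFunction h) {Λ : Measure ℝ}
    (hΛ : IsLevyMeasure Λ) (v : NNReal) (b t : ℝ) {S : Set ℝ} (hS : MeasurableSet S)
    (hi : Integrable (compExp h t S) Λ) (n : ℕ) :
    ∫⁻ x, ENNReal.ofReal (Real.exp (t * x)) ∂(levyApprox h v b Λ S n) =
      ENNReal.ofReal (Real.exp (b * t + v * t ^ 2 / 2 +
        ∫ x, compExp h t S x ∂(bigJumps Λ n))) := by
  have := hΛ.isFiniteMeasure_bigJumps n
  have hhn := hh.integrable (bigJumps Λ n)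
  have hin : Integrable (compExp h t S) (bigJumps Λ n) := hi.mono_measure Measure.restrict_le_self
  have hind : Integrable (S.indicator fun y => Real.exp (t * y)) (bigJumps Λ n) := by
    refine ((hin.add (integrable_const 1)).add (hhn.const_mul t)).congr (ae_of_all _ fun x => ?_)
    simp only [compExp, Pi.add_apply]
    ring
  have heq : ∫ x, compExp h t S x ∂(bigJumps Λ n) =
      (∫ x in S, Real.exp (t * x) ∂(bigJumps Λ n)) - (bigJumps Λ n).real Set.univ -
        t * ∫ x, h x ∂(bigJumps Λ n) := by
    have := integral_sub_one_sub_const_mul hind hhn t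
    rwa [integral_indicator hS] at this
  rw [levyApprox, lintegral_exp_gaussConvExp ((integrable_indicator_iff hS).1 hind), heq]
  congr 2
  ring

lemma tendsto_lintegral_exp_levyApprox {h : ℝ → ℝ} (hh : IsCenteringFunction h) {Λ : Measure ℝ}
    (hΛ : IsLevyMeasure Λ) (v : NNReal) (b t : ℝ) {S : Set ℝ} (hS : MeasurableSet S)
    (hi : Integrable (compExp h t S) Λ) :
    Tendsto (fun n => ∫⁻ x, ENNReal.ofReal (Real.exp (t * x)) ∂(levyApprox h v b Λ S n)) atTop
      (𝓝 (ENNReal.ofReal (Real.exp (b * t + v * t ^ 2 / 2 + ∫ x, compExp h t S x ∂Λ)))) := by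
  simp_rw [lintegral_exp_levyApprox hh hΛ v b t hS hi]
  exact ENNReal.tendsto_ofReal ((Real.continuous_exp.tendsto _).comp
    (tendsto_const_nhds.add (hΛ.tendsto_integral_bigJumps hi)))

/-- Weak convergence of the approximations, tested on truncated exponentials. -/
lemma tendsto_lintegral_min_exp_levyApprox {μ : Measure ℝ} [IsProbabilityMeasure μ] {h : ℝ → ℝ}
    (hh : IsCenteringFunction h) {σ2 b : ℝ} {Λ : Measure ℝ} (hμ : HasCharacteristics μ h σ2 b Λ)
    (t K : ℝ) :
    Tendsto (fun n => ∫⁻ x, ENNReal.ofReal (min (Real.exp (t * x)) K)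
        ∂(levyApprox h σ2.toNNReal b Λ Set.univ n)) atTop
      (𝓝 (∫⁻ x, ENNReal.ofReal (min (Real.exp (t * x)) K) ∂μ)) := by
  have hp := isProbabilityMeasure_levyApprox hμ.levy h σ2.toNNReal b
  let A : ℕ → ProbabilityMeasure ℝ := fun n => ⟨levyApprox h σ2.toNNReal b Λ Set.univ n, hp n⟩
  let μ₀ : ProbabilityMeasure ℝ := ⟨μ, inferInstance⟩
  have hweak : Tendsto A atTop (𝓝 μ₀) := by
    refine ProbabilityMeasure.tendsto_iff_tendsto_charFun.2 fun u => ?_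
    change Tendsto (fun n => charFun (levyApprox h σ2.toNNReal b Λ Set.univ n) u) atTop
      (𝓝 (charFun μ u))
    have := tendsto_charFun_levyApprox hh hμ.levy σ2.toNNReal b u
    rwa [Real.coe_toNNReal _ hμ.nonneg, ← hμ.charFun_eq] at this
  let f : BoundedContinuousFunction ℝ NNReal := BoundedContinuousFunction.mkOfBound
    ⟨fun x => (min (Real.exp (t * x)) K).toNNReal, by fun_prop⟩ K.toNNReal fun x y => by
      have hle (z : ℝ) : (min (Real.exp (t * z)) K).toNNReal ≤ K.toNNReal :=
        Real.toNNReal_le_toNNReal (min_le_right _ _)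
      rw [NNReal.dist_eq]
      exact abs_sub_le_of_nonneg_of_le (NNReal.coe_nonneg _) (hle x) (NNReal.coe_nonneg _) (hle y)
  exact ProbabilityMeasure.tendsto_iff_forall_lintegral_tendsto.1 hweak f

/-! ### The exponential moment -/

/-- The upper bound, by Fatou's lemma for weak convergence. -/
lemma lintegral_exp_le {μ : Measure ℝ} [IsProbabilityMeasure μ] {h : ℝ → ℝ}
    (hh : IsCenteringFunction h) {σ2 b : ℝ} {Λ : Measure ℝ} (hμ : HasCharacteristics μ h σ2 b Λ)
    {t : ℝ} (hi : Integrable (compExp h t Set.univ) Λ) :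
    ∫⁻ x, ENNReal.ofReal (Real.exp (t * x)) ∂μ ≤
      ENNReal.ofReal (Real.exp (b * t + σ2 * t ^ 2 / 2 + ∫ x, compExp h t Set.univ x ∂Λ)) := by
  have hlim := tendsto_lintegral_exp_levyApprox hh hμ.levy σ2.toNNReal b t MeasurableSet.univ hi
  rw [Real.coe_toNNReal _ hμ.nonneg] at hlim
  have hK (K : ℕ) : ∫⁻ x, ENNReal.ofReal (min (Real.exp (t * x)) K) ∂μ ≤
      ENNReal.ofReal (Real.exp (b * t + σ2 * t ^ 2 / 2 + ∫ x, compExp h t Set.univ x ∂Λ)) :=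
    le_of_tendsto_of_tendsto' (tendsto_lintegral_min_exp_levyApprox hh hμ t K) hlim fun n =>
      lintegral_mono fun x => ENNReal.ofReal_le_ofReal (min_le_left _ _)
  refine le_of_tendsto' (lintegral_tendsto_of_tendsto_of_monotone
    (f := fun (K : ℕ) x => ENNReal.ofReal (min (Real.exp (t * x)) K)) (fun K => by fun_prop)
    (ae_of_all _ fun x K L hKL => ?_) (ae_of_all _ fun x => ?_)) hK
  · exact ENNReal.ofReal_le_ofReal (min_le_min_left _ (by exact_mod_cast hKL))
  · refine tendsto_const_nhds.congr' ?_
    filter_upwards [eventually_ge_atTop ⌈Real.exp (t * x)⌉₊] with K hK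
    rw [min_eq_left (Nat.ceil_le.1 hK)]

/-- The lower bound for the measures with jumps outside `S` removed. Finiteness of the limiting
moment of order `2 t` gives the uniform integrability which turns weak convergence into
convergence of the moments of order `t`. -/
lemma le_lintegral_exp {μ : Measure ℝ} [IsProbabilityMeasure μ] {h : ℝ → ℝ}
    (hh : IsCenteringFunction h) {σ2 b : ℝ} {Λ : Measure ℝ} (hμ : HasCharacteristics μ h σ2 b Λ)
    {t : ℝ} {S : Set ℝ} (hS : MeasurableSet S) (hi : Integrable (compExp h t S) Λ)
    (hi2 : Integrable (compExp h (2 * t) S) Λ) :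
    ENNReal.ofReal (Real.exp (b * t + σ2 * t ^ 2 / 2 + ∫ x, compExp h t S x ∂Λ)) ≤
      ∫⁻ x, ENNReal.ofReal (Real.exp (t * x)) ∂μ := by
  have hlim := tendsto_lintegral_exp_levyApprox hh hμ.levy σ2.toNNReal b t hS hi
  have hlim2 := tendsto_lintegral_exp_levyApprox hh hμ.levy σ2.toNNReal b (2 * t) hS hi2
  rw [Real.coe_toNNReal _ hμ.nonneg] at hlim hlim2
  set L2 := ENNReal.ofReal (Real.exp (b * (2 * t) + σ2 * (2 * t) ^ 2 / 2 +
    ∫ x, compExp h (2 * t) S x ∂Λ))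
  -- Beyond the level `K + 1` the exponential is at most its square divided by `K + 1`.
  have hpt (K : ℕ) (x : ℝ) : ENNReal.ofReal (Real.exp (t * x)) ≤
      ENNReal.ofReal (min (Real.exp (t * x)) (K + 1 : ℝ)) +
        ENNReal.ofReal (1 / (K + 1 : ℝ)) * ENNReal.ofReal (Real.exp (2 * t * x)) := by
    rw [← ENNReal.ofReal_mul (by positivity), ← ENNReal.ofReal_add (by positivity)
      (by positivity)]
    refine ENNReal.ofReal_le_ofReal ?_
    have hE := Real.exp_pos (t * x)
    have h2 : Real.exp (2 * t * x) = Real.exp (t * x) * Real.exp (t * x) := by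
      rw [← Real.exp_add]
      ring_nf
    rcases le_total (Real.exp (t * x)) (K + 1 : ℝ) with hle | hle
    · rw [min_eq_left hle]
      exact le_add_of_nonneg_right (by positivity)
    · rw [min_eq_right hle, h2, one_div_mul_eq_div]
      have : Real.exp (t * x) ≤ Real.exp (t * x) * Real.exp (t * x) / (K + 1) := by
        rw [le_div_iff₀ (by positivity)]
        gcongr
      have : (0 : ℝ) ≤ K + 1 := by positivity
      linarith
  -- The main part is compared with the probability measures `levyApprox … univ n`, which converge
  -- weakly; only the error term uses the moments of the smaller measures.
  have hK (K : ℕ) : ENNReal.ofReal (Real.exp (b * t + σ2 * t ^ 2 / 2 +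
      ∫ x, compExp h t S x ∂Λ)) ≤ (∫⁻ x, ENNReal.ofReal (Real.exp (t * x)) ∂μ) +
        ENNReal.ofReal (1 / (K + 1 : ℝ)) * L2 := by
    have hstep : ENNReal.ofReal (Real.exp (b * t + σ2 * t ^ 2 / 2 +
        ∫ x, compExp h t S x ∂Λ)) ≤
          (∫⁻ x, ENNReal.ofReal (min (Real.exp (t * x)) (K + 1 : ℝ)) ∂μ) +
            ENNReal.ofReal (1 / (K + 1 : ℝ)) * L2 := by
      refine le_of_tendsto_of_tendsto' hlim
        ((tendsto_lintegral_min_exp_levyApprox hh hμ t (K + 1)).add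
          (ENNReal.Tendsto.const_mul hlim2 (Or.inr ENNReal.ofReal_ne_top))) fun n => ?_
      calc _ ≤ ∫⁻ x, (ENNReal.ofReal (min (Real.exp (t * x)) (K + 1 : ℝ)) +
            ENNReal.ofReal (1 / (K + 1 : ℝ)) * ENNReal.ofReal (Real.exp (2 * t * x)))
              ∂(levyApprox h σ2.toNNReal b Λ S n) := lintegral_mono (hpt K)
        _ = (∫⁻ x, ENNReal.ofReal (min (Real.exp (t * x)) (K + 1 : ℝ))
              ∂(levyApprox h σ2.toNNReal b Λ S n)) + ENNReal.ofReal (1 / (K + 1 : ℝ)) *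
            ∫⁻ x, ENNReal.ofReal (Real.exp (2 * t * x)) ∂(levyApprox h σ2.toNNReal b Λ S n) := by
          rw [lintegral_add_left (by fun_prop), lintegral_const_mul _ (by fun_prop)]
        _ ≤ _ := by
          gcongr
          exact levyApprox_le hμ.levy h _ b S n
    refine hstep.trans (add_le_add_left (lintegral_mono fun x => ?_) _)
    exact ENNReal.ofReal_le_ofReal (min_le_left _ _)
  have hlimK : Tendsto (fun K : ℕ => (∫⁻ x, ENNReal.ofReal (Real.exp (t * x)) ∂μ) +
      ENNReal.ofReal (1 / (K + 1 : ℝ)) * L2) atTop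
      (𝓝 ((∫⁻ x, ENNReal.ofReal (Real.exp (t * x)) ∂μ) + ENNReal.ofReal 0 * L2)) :=
    tendsto_const_nhds.add (ENNReal.Tendsto.mul_const
      (ENNReal.tendsto_ofReal tendsto_one_div_add_atTop_nhds_zero_nat)
      (Or.inr ENNReal.ofReal_ne_top))
  simpa using ge_of_tendsto' hlimK hK

lemma compExp_mono (h : ℝ → ℝ) (t x : ℝ) {S T : Set ℝ} (hST : S ⊆ T) :
    compExp h t S x ≤ compExp h t T x := by
  have := Set.indicator_le_indicator_of_subset (f := fun y => Real.exp (t * y)) hST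
    (fun y => Real.exp_nonneg (t * y)) x
  unfold compExp
  linarith

lemma monotone_Icc_neg : Monotone fun N : ℕ => Set.Icc (-((N : ℝ) + 1)) ((N : ℝ) + 1) := by
  intro N M hNM
  have : (N : ℝ) ≤ M := by exact_mod_cast hNM
  exact Set.Icc_subset_Icc (by linarith) (by linarith)

lemma tendsto_compExp_Icc (h : ℝ → ℝ) (t x : ℝ) :
    Tendsto (fun N : ℕ => compExp h t (Set.Icc (-((N : ℝ) + 1)) ((N : ℝ) + 1)) x) atTop
      (𝓝 (compExp h t Set.univ x)) := by
  refine tendsto_const_nhds.congr' ?_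
  filter_upwards [eventually_ge_atTop ⌈|x|⌉₊] with N hN
  have hx : |x| ≤ (N : ℝ) + 1 := (Nat.ceil_le.1 hN).trans (by linarith)
  have hmem : x ∈ Set.Icc (-((N : ℝ) + 1)) ((N : ℝ) + 1) := abs_le.1 hx
  rw [compExp, compExp, Set.indicator_of_mem (Set.mem_univ x), Set.indicator_of_mem hmem]

lemma le_lintegral_exp_Icc {μ : Measure ℝ} [IsProbabilityMeasure μ] {h : ℝ → ℝ}
    (hh : IsCenteringFunction h) {σ2 b : ℝ} {Λ : Measure ℝ} (hμ : HasCharacteristics μ h σ2 b Λ)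
    (t : ℝ) (N : ℕ) :
    ENNReal.ofReal (Real.exp (b * t + σ2 * t ^ 2 / 2 +
      ∫ x, compExp h t (Set.Icc (-((N : ℝ) + 1)) ((N : ℝ) + 1)) x ∂Λ)) ≤
      ∫⁻ x, ENNReal.ofReal (Real.exp (t * x)) ∂μ := by
  have hN : (1 : ℝ) ≤ (N : ℝ) + 1 := by simp
  exact le_lintegral_exp hh hμ measurableSet_Icc (integrable_compExp_Icc hh hμ.levy t hN)
    (integrable_compExp_Icc hh hμ.levy (2 * t) hN)

/-- If the exponential moment is finite, the lower bounds keep the integrals of the truncated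
integrands bounded, and monotone convergence gives integrability of the full integrand. -/
lemma integrable_compExp_of_lintegral_exp_lt_top {μ : Measure ℝ} [IsProbabilityMeasure μ]
    {h : ℝ → ℝ} (hh : IsCenteringFunction h) {σ2 b : ℝ} {Λ : Measure ℝ}
    (hμ : HasCharacteristics μ h σ2 b Λ) {t : ℝ}
    (hE : ∫⁻ x, ENNReal.ofReal (Real.exp (t * x)) ∂μ < ∞) :
    Integrable (compExp h t Set.univ) Λ := by
  set g : ℕ → ℝ → ℝ := fun N => compExp h t (Set.Icc (-((N : ℝ) + 1)) ((N : ℝ) + 1))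
  have hgi (N : ℕ) : Integrable (g N) Λ := integrable_compExp_Icc hh hμ.levy t (by simp)
  have hg0 (N : ℕ) (x : ℝ) : 0 ≤ g N x - g 0 x :=
    sub_nonneg.2 (compExp_mono h t x (monotone_Icc_neg (Nat.zero_le N)))
  have hgle (x : ℝ) : 0 ≤ compExp h t Set.univ x - g 0 x :=
    sub_nonneg.2 (compExp_mono h t x (Set.subset_univ _))
  -- The bound on `∫ (g N - g 0)` obtained by taking logarithms in `le_lintegral_exp_Icc`.
  set M := Real.log (∫⁻ x, ENNReal.ofReal (Real.exp (t * x)) ∂μ).toReal -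
    (b * t + σ2 * t ^ 2 / 2) - ∫ x, g 0 x ∂Λ
  have hbound (N : ℕ) : ∫⁻ x, ENNReal.ofReal (g N x - g 0 x) ∂Λ ≤ ENNReal.ofReal M := by
    have hd : Integrable (fun x => g N x - g 0 x) Λ := (hgi N).sub (hgi 0)
    rw [← ofReal_integral_eq_lintegral_ofReal hd (ae_of_all _ (hg0 N)),
      integral_sub (hgi N) (hgi 0)]
    refine ENNReal.ofReal_le_ofReal ?_
    have h1 : Real.exp (b * t + σ2 * t ^ 2 / 2 + ∫ x, g N x ∂Λ) ≤ _ :=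
      (ENNReal.ofReal_le_iff_le_toReal hE.ne).1 (le_lintegral_exp_Icc hh hμ t N)
    have h2 := Real.log_le_log (Real.exp_pos _) h1
    rw [Real.log_exp] at h2
    rw [le_sub_iff_add_le, sub_add_cancel]
    linarith
  have hlim : ∫⁻ x, ENNReal.ofReal (compExp h t Set.univ x - g 0 x) ∂Λ ≤ ENNReal.ofReal M := by
    refine le_of_tendsto' (lintegral_tendsto_of_tendsto_of_monotone
      (f := fun N x => ENNReal.ofReal (g N x - g 0 x))
      (fun N => ((hgi N).sub (hgi 0)).aestronglyMeasurable.aemeasurable.ennreal_ofReal)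
      (ae_of_all _ fun x N K hNK => ?_) (ae_of_all _ fun x => ?_)) hbound
    · exact ENNReal.ofReal_le_ofReal
        (sub_le_sub_right (compExp_mono h t x (monotone_Icc_neg hNK)) _)
    · exact ENNReal.tendsto_ofReal ((tendsto_compExp_Icc h t x).sub_const _)
  have hd : Integrable (fun x => compExp h t Set.univ x - g 0 x) Λ := by
    refine ⟨((measurable_compExp hh t MeasurableSet.univ).sub
      (measurable_compExp hh t measurableSet_Icc)).aestronglyMeasurable, ?_⟩
    rw [hasFiniteIntegral_iff_ofReal (ae_of_all _ hgle)]
    exact hlim.trans_lt ENNReal.ofReal_lt_top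
  refine (hd.add (hgi 0)).congr (ae_of_all _ fun x => ?_)
  simp

/-- The lower bounds for the truncations to `[-N - 1, N + 1]` pass to the limit by dominated
convergence. -/
lemma lintegral_exp_eq {μ : Measure ℝ} [IsProbabilityMeasure μ] {h : ℝ → ℝ}
    (hh : IsCenteringFunction h) {σ2 b : ℝ} {Λ : Measure ℝ} (hμ : HasCharacteristics μ h σ2 b Λ)
    {t : ℝ} (hi : Integrable (compExp h t Set.univ) Λ) :
    ∫⁻ x, ENNReal.ofReal (Real.exp (t * x)) ∂μ =
      ENNReal.ofReal (Real.exp (b * t + σ2 * t ^ 2 / 2 + ∫ x, compExp h t Set.univ x ∂Λ)) := by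
  refine le_antisymm (lintegral_exp_le hh hμ hi) ?_
  set g : ℕ → ℝ → ℝ := fun N => compExp h t (Set.Icc (-((N : ℝ) + 1)) ((N : ℝ) + 1))
  have hgi (N : ℕ) : Integrable (g N) Λ := integrable_compExp_Icc hh hμ.levy t (by simp)
  have hlim : Tendsto (fun N => ∫ x, g N x ∂Λ) atTop (𝓝 (∫ x, compExp h t Set.univ x ∂Λ)) := by
    refine tendsto_integral_of_dominated_convergence
      (fun x => |g 0 x| + |compExp h t Set.univ x|) (fun N => (hgi N).aestronglyMeasurable)
      ((hgi 0).abs.add hi.abs) (fun N => ae_of_all _ fun x => ?_)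
      (ae_of_all _ fun x => tendsto_compExp_Icc h t x)
    have h1 : g 0 x ≤ g N x := compExp_mono h t x (monotone_Icc_neg (Nat.zero_le N))
    have h2 : g N x ≤ compExp h t Set.univ x := compExp_mono h t x (Set.subset_univ _)
    rw [Real.norm_eq_abs, abs_le]
    constructor
    · linarith [neg_abs_le (g 0 x), abs_nonneg (compExp h t Set.univ x)]
    · linarith [le_abs_self (compExp h t Set.univ x), abs_nonneg (g 0 x)]
  exact le_of_tendsto' (ENNReal.tendsto_ofReal ((Real.continuous_exp.tendsto _).comp
    (tendsto_const_nhds.add hlim))) (le_lintegral_exp_Icc hh hμ t)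

/-- The integrand dominates its truncation to `[-1, 1]`, which is integrable; so its integral never
takes the value `-∞`. -/
lemma lintegral_neg_compExp_lt_top {h : ℝ → ℝ} (hh : IsCenteringFunction h) {Λ : Measure ℝ}
    (hΛ : IsLevyMeasure Λ) (t : ℝ) :
    ∫⁻ x, ENNReal.ofReal (-compExp h t Set.univ x) ∂Λ < ∞ := by
  have hi := integrable_compExp_Icc hh hΛ t le_rfl
  refine (lintegral_mono fun x => ?_).trans_lt hi.neg.lintegral_lt_top
  exact ENNReal.ofReal_le_ofReal (neg_le_neg (compExp_mono h t x (Set.subset_univ _)))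

/-! ### The extended-real integral -/

lemma extIntegral_eq_coe {Λ : Measure ℝ} {f : ℝ → ℝ} (hf : Integrable f Λ) :
    extIntegral Λ f = ((∫ x, f x ∂Λ : ℝ) : EReal) := by
  have hneg : ∫⁻ x, ENNReal.ofReal (-f x) ∂Λ < ∞ := hf.neg.lintegral_lt_top
  rw [extIntegral, integral_eq_lintegral_pos_part_sub_lintegral_neg_part hf, EReal.coe_sub,
    EReal.coe_ennreal_toReal hf.lintegral_lt_top.ne,
    EReal.coe_ennreal_toReal hneg.ne]

lemma extIntegral_eq_top {Λ : Measure ℝ} {f : ℝ → ℝ} (hm : AEStronglyMeasurable f Λ)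
    (hneg : ∫⁻ x, ENNReal.ofReal (-f x) ∂Λ < ∞) (hf : ¬ Integrable f Λ) :
    extIntegral Λ f = ⊤ := by
  have hpos : ∫⁻ x, ENNReal.ofReal (f x) ∂Λ = ∞ := by
    by_contra hne
    refine hf ⟨hm, ?_⟩
    rw [hasFiniteIntegral_iff_norm]
    refine (lintegral_mono fun x => ?_).trans_lt
      ((lintegral_add_left' hm.aemeasurable.ennreal_ofReal _).trans_lt
        (ENNReal.add_lt_top.2 ⟨lt_top_iff_ne_top.2 hne, hneg⟩))
    rcases le_total 0 (f x) with h0 | h0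
    · simp [abs_of_nonneg h0]
    · simp [abs_of_nonpos h0]
  rw [extIntegral, hpos]
  lift ∫⁻ x, ENNReal.ofReal (-f x) ∂Λ to NNReal using hneg.ne with r
  exact EReal.top_sub_coe r

/-- The first conjunct says that the integral in the exponent is a well-defined element of
`(-∞, ∞]`. The expectation of `exp (t X)` is the integral of a nonnegative function with values
in `[0, ∞]`, and `EReal.exp` is the exponential function `[-∞, ∞] → [0, ∞]`. -/
theorem mainTheorem7 {Ω : Type*} [MeasurableSpace Ω] (P : Measure Ω) [IsProbabilityMeasure P]
    (X : Ω → ℝ) (hX : AEMeasurable X P)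
    (h : ℝ → ℝ) (hh : IsCenteringFunction h)
    (σ2 b : ℝ) (Λ : Measure ℝ)
    (hdiv : IsInfinitelyDivisible (P.map X))
    (hchar : HasCharacteristics (P.map X) h σ2 b Λ)
    (t : ℝ) :
    (∫⁻ x, ENNReal.ofReal (-(Real.exp (t * x) - 1 - t * h x)) ∂Λ < ∞) ∧
    (∫⁻ ω, ENNReal.ofReal (Real.exp (t * X ω)) ∂P =
      EReal.exp (((b * t + σ2 * t ^ 2 / 2 : ℝ) : EReal) +
        extIntegral Λ (fun x => Real.exp (t * x) - 1 - t * h x))) ∧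
    (∫⁻ ω, ENNReal.ofReal (Real.exp (t * X ω)) ∂P < ∞ ↔
      extIntegral Λ (fun x => Real.exp (t * x) - 1 - t * h x) < ⊤) ∧
    (0 < t → (∫⁻ ω, ENNReal.ofReal (Real.exp (t * X ω)) ∂P < ∞ ↔
      ∫⁻ x in Set.Ioi 1, ENNReal.ofReal (Real.exp (t * x)) ∂Λ < ∞)) ∧
    (t < 0 → (∫⁻ ω, ENNReal.ofReal (Real.exp (t * X ω)) ∂P < ∞ ↔
      ∫⁻ x in Set.Iio (-1), ENNReal.ofReal (Real.exp (t * x)) ∂Λ < ∞)) := by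
  have hp : IsProbabilityMeasure (P.map X) := Measure.isProbabilityMeasure_map hX
  have hΛ := hchar.levy
  have hf : compExp h t Set.univ = fun x => Real.exp (t * x) - 1 - t * h x := by
    ext x
    rw [compExp, Set.indicator_univ]
  have hmap : ∫⁻ ω, ENNReal.ofReal (Real.exp (t * X ω)) ∂P =
      ∫⁻ x, ENNReal.ofReal (Real.exp (t * x)) ∂(P.map X) :=
    (lintegral_map' (f := fun x => ENNReal.ofReal (Real.exp (t * x))) (by fun_prop) hX).symm
  have hneg := lintegral_neg_compExp_lt_top hh hΛ t
  have hiff : ∫⁻ x, ENNReal.ofReal (Real.exp (t * x)) ∂(P.map X) < ∞ ↔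
      Integrable (compExp h t Set.univ) Λ :=
    ⟨integrable_compExp_of_lintegral_exp_lt_top hh hchar, fun hi => by
      rw [lintegral_exp_eq hh hchar hi]; exact ENNReal.ofReal_lt_top⟩
  have htop (hi : ¬ Integrable (compExp h t Set.univ) Λ) :
      extIntegral Λ (compExp h t Set.univ) = ⊤ :=
    extIntegral_eq_top (measurable_compExp hh t MeasurableSet.univ).aestronglyMeasurable hneg hi
  rw [hmap, ← hf]
  refine ⟨by simpa only [hf] using hneg, ?_, ?_, fun ht => ?_, fun ht => ?_⟩
  · by_cases hi : Integrable (compExp h t Set.univ) Λ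
    · rw [lintegral_exp_eq hh hchar hi, extIntegral_eq_coe hi, ← EReal.coe_add, EReal.exp_coe]
    · rw [htop hi, EReal.coe_add_top, EReal.exp_top]
      exact not_lt_top_iff.1 fun hE => hi (hiff.1 hE)
  · rw [hiff]
    refine ⟨fun hi => ?_, fun hlt => ?_⟩
    · rw [extIntegral_eq_coe hi]
      exact EReal.coe_lt_top _
    · by_contra hi
      exact hlt.ne (htop hi)
  · rw [hiff, integrable_compExp_univ_iff_of_pos hh hΛ ht]
  · rw [hiff, integrable_compExp_univ_iff_of_neg hh hΛ ht]
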